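/- Let $(G_i)_{i=1}^\infty$ be a sequence of countable groups, each equipped with a proper left-invariant metric $d$ (closed balls are compact) and each of finite asymptotic dimension. Assume that for every real $r$, for all but finitely many $i$, one has $i\cdot d(g,e)\ge r$ for all $g\in G_i\setminus\{e\}$ (this holds for instance if distinct points of each $G_i$ are at distance at least $1$). Let $\times_{i=1}^\infty G_i$ be the set of sequences $(a_i)$ with $a_i\in G_i$ and $a_i=e$ for all but finitely many $i$, with the metric $d((a_i),(b_i))=\sum_{i=1}^\infty i\cdot d(a_i,b_i)$. Then $\times_{i=1}^\infty G_i$ has asymptotic property C. Here a family $\mathcal U$ of nonempty subsets of a metric space $X$ is $R$-disjoint if $\inf\{d(a,b): a\in A,\ b\in B\}>R$ for all distinct $A,B\in\mathcal U$, and uniformly bounded if $\sup_{U\in\mathcal U}\operatorname{diam}U<\infty$. $X$ has finite asymptotic dimension if there is $n$ such that for every $R>0$ there are uniformly bounded $R$-disjoint families $\mathcal U_0,\dots,\mathcal U_n$ of subsets of $X$ with $\bigcup_{i=0}^n\mathcal U_i$ a cover of $X$. $X$ has asymptotic property C if for every sequence $R_0\le R_1\le R_2\le\cdots$ of positive reals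 there are $n\ge 0$ and uniformly bounded families $\mathcal U_0,\dots,\mathcal U_n$ of subsets of $X$, with $\mathcal U_i$ being $R_i$-disjoint, such that $\bigcup_{i=0}^n\mathcal U_i$ is a cover of $X$. -/

import Mathlib

namespace AsympC

/-- The distance `d(A, B) = inf {d(a, b) : a ∈ A, b ∈ B}` between two subsets (used only for
nonempty sets, where the set of reals below is nonempty and bounded below by `0`). -/
noncomputable def setDist {X : Type*} [MetricSpace X] (A B : Set X) : ℝ :=
  sInf (Set.image2 dist A B)

/-- A family of nonempty subsets is `R`-disjoint if any two distinct members are at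
distance greater than `R`. -/
def RDisjoint {X : Type*} [MetricSpace X] (R : ℝ) (𝒰 : Set (Set X)) : Prop :=
  (∀ A ∈ 𝒰, A.Nonempty) ∧ ∀ A ∈ 𝒰, ∀ B ∈ 𝒰, A ≠ B → R < setDist A B

/-- A family of subsets is uniformly bounded if the diameters of its members have a common
finite bound. -/
def UniformlyBounded {X : Type*} [MetricSpace X] (𝒰 : Set (Set X)) : Prop :=
  ∃ D : ℝ, ∀ U ∈ 𝒰, ∀ x ∈ U, ∀ y ∈ U, dist x y ≤ D

/-- `asdim X ≤ n`: for every `R > 0` there are `n + 1` uniformly bounded `R`-disjoint families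
that together cover `X`. -/
def AsdimLE (X : Type*) [MetricSpace X] (n : ℕ) : Prop :=
  ∀ R : ℝ, 0 < R → ∃ 𝒰 : ℕ → Set (Set X),
    (∀ i ≤ n, UniformlyBounded (𝒰 i) ∧ RDisjoint R (𝒰 i)) ∧
      ∀ x : X, ∃ i ≤ n, ∃ U ∈ 𝒰 i, x ∈ U

/-- Finite asymptotic dimension. -/
def FiniteAsdim (X : Type*) [MetricSpace X] : Prop :=
  ∃ n : ℕ, AsdimLE X n

/-- Asymptotic property C. -/
def AsymptoticPropertyC (X : Type*) [MetricSpace X] : Prop :=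
  ∀ R : ℕ → ℝ, (∀ i, 0 < R i) → Monotone R →
    ∃ (n : ℕ) (𝒰 : ℕ → Set (Set X)),
      (∀ i ≤ n, UniformlyBounded (𝒰 i) ∧ RDisjoint (R i) (𝒰 i)) ∧
        ∀ x : X, ∃ i ≤ n, ∃ U ∈ 𝒰 i, x ∈ U

/-- The restricted product of a sequence of pointed sets `(X i, p i)`: the sequences which agree
with the base points at all but finitely many indices. The sequence is indexed by `ℕ`, so that
the index `i` here is the `(i + 1)`-st factor. -/
@[ext]
structure RestrictedProd (X : ℕ → Type*) (p : ∀ i, X i) where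
  val : ∀ i, X i
  finite_ne : {i | val i ≠ p i}.Finite

namespace RestrictedProd

variable {X : ℕ → Type*} [∀ i, MetricSpace (X i)] {p : ∀ i, X i}

/-- The distance `∑ i · d(a_i, b_i)`, the sum over the factors numbered from `1`. -/
noncomputable instance : Dist (RestrictedProd X p) :=
  ⟨fun a b => ∑' i : ℕ, ((i : ℝ) + 1) * dist (a.val i) (b.val i)⟩

theorem dist_def (a b : RestrictedProd X p) :
    dist a b = ∑' i : ℕ, ((i : ℝ) + 1) * dist (a.val i) (b.val i) := rfl

theorem summable_dist (a b : RestrictedProd X p) :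
    Summable fun i : ℕ => ((i : ℝ) + 1) * dist (a.val i) (b.val i) := by
  apply summable_of_hasFiniteSupport
  refine (a.finite_ne.union b.finite_ne).subset fun i hi => ?_
  by_contra h
  simp only [Set.mem_union, Set.mem_ofPred_eq, not_or, not_not] at h
  exact hi (by simp [h.1, h.2])

noncomputable instance : MetricSpace (RestrictedProd X p) where
  dist_self a := by simp [dist_def]
  dist_comm a b := by simp [dist_def, dist_comm]
  dist_triangle a b c := by
    simp only [dist_def]
    rw [← (summable_dist a b).tsum_add (summable_dist b c)]
    refine (summable_dist a c).tsum_le_tsum (fun i => ?_)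
      ((summable_dist a b).add (summable_dist b c))
    rw [← mul_add]
    exact mul_le_mul_of_nonneg_left (dist_triangle _ _ _) (by positivity)
  eq_of_dist_eq_zero {a b} h := by
    ext i
    have h0 := (summable_dist a b).le_tsum i (fun j _ => by positivity)
    rw [← dist_def, h] at h0
    have hi : (0 : ℝ) < (i : ℝ) + 1 := by positivity
    exact dist_le_zero.1 (nonpos_of_mul_nonpos_right h0 hi)

end RestrictedProd

end AsympC

/-!
Split off the first `k₀` factors, `H`, where `k₀` is so large that points of the product differing
in a later factor are at distance greater than `R 0`. Being a finite product, `H` has a cover by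
`N` bounded families at every scale. Put `L = N ^ 3`, let `T` be the product of the factors from
`k₀` to `k`, where `k` is so large that points differing beyond `k` are at distance greater than
`R L`, and colour `T` with finitely many colours whose classes are bounded at scale `R L`. The
number of colours of `T` cannot be controlled in terms of `L`, and the point is that it does not
have to be.

By Kolmogorov's trick (`CoverableBy.exists_overlapping`), `H` carries one family `F c` for each
colour `c` of `T`, all of them bounded at a scale far above `R L`, such that a point of `H` is
missed by at most `N` of them. The first family of the cover consists of the points whose
component `h` in `H` lies in a fixed enlargement of `F c`, where `c` is the colour of their
component in `T`: since points differing in `T` are far apart at scale `R 0`, this is bounded at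
scale `R 0`.

For the remaining points, let `S s h` be the set of those `c` such that `h` is outside the `s`-th
enlargement of `F c`. These sets decrease with `s` and start with at most `N` elements, so
`S (2a) h = S (2a+2) h` for some `a < N`. On the points with a given such `a`, the set
`S (2a+1) h` is locally constant at scale `R L`, hence the colour `c` is locally determined by its
rank, a number less than `N`, in this set. The remaining points are therefore covered by `N ^ 3`
pieces bounded at scale `R L`, indexed by `a`, this rank, and the index of `h` in a cover of `H`
by `N` families (`exists_cover_of_split`).
-/

namespace AsympC

open Finset

/-! ### Sets that are bounded at a given scale -/

/-- `P` is a union of pieces of diameter at most `D`, distinct pieces being at distance greater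
than `R`. The pieces are the classes in `P` of an equivalence relation on the whole space. -/
def BoundedAtScale {X : Type*} [MetricSpace X] (R D : ℝ) (P : Set X) : Prop :=
  ∃ s : Setoid X, (∀ x ∈ P, ∀ y ∈ P, dist x y ≤ R → s x y) ∧
    ∀ x ∈ P, ∀ y ∈ P, s x y → dist x y ≤ D

/-- At every scale, `X` is covered by `N` sets that are bounded at that scale. -/
def CoverableBy (X : Type*) [MetricSpace X] (N : ℕ) : Prop :=
  ∀ R : ℝ, ∃ (D : ℝ) (F : Fin N → Set X), (∀ i, BoundedAtScale R D (F i)) ∧ ∀ x, ∃ i, x ∈ F i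

variable {X : Type*} [MetricSpace X]

theorem BoundedAtScale.mono {R R' D D' : ℝ} {P : Set X} (h : BoundedAtScale R D P)
    (hR : R' ≤ R) (hD : D ≤ D') : BoundedAtScale R' D' P := by
  obtain ⟨s, h1, h2⟩ := h
  exact ⟨s, fun x hx y hy hxy => h1 x hx y hy (hxy.trans hR),
    fun x hx y hy hxy => (h2 x hx y hy hxy).trans hD⟩

theorem boundedAtScale_empty (R D : ℝ) : BoundedAtScale R D (∅ : Set X) :=
  ⟨⊤, by simp, by simp⟩

/-- The closed `r`-neighbourhood of `P`, with the distance to `P` attained. -/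
def enlarge (r : ℝ) (P : Set X) : Set X := {x | ∃ y ∈ P, dist x y ≤ r}

theorem BoundedAtScale.enlarge {R D r : ℝ} {P : Set X} (h : BoundedAtScale (R + 2 * r) D P) :
    BoundedAtScale R (D + 2 * r) (enlarge r P) := by
  obtain ⟨s, h1, h2⟩ := h
  have key : ∀ x, x ∈ AsympC.enlarge r P → ∃ y, y ∈ P ∧ dist x y ≤ r := fun x hx => hx
  choose! f hfP hfd using key
  refine ⟨s.comap f, fun x hx y hy hxy => ?_, fun x hx y hy hxy => ?_⟩
  · refine h1 _ (hfP x hx) _ (hfP y hy) ?_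
    have := dist_triangle4 (f x) x y (f y)
    have := dist_comm (f x) x
    linarith [hfd x hx, hfd y hy]
  · have := h2 _ (hfP x hx) _ (hfP y hy) hxy
    have := dist_triangle4 x (f x) (f y) y
    have := dist_comm (f y) y
    linarith [hfd x hx, hfd y hy]

/-- Boundedness at scale `R` may be checked on the fibres of a function which is locally constant
at scale `R`. -/
theorem boundedAtScale_of_fibers {κ : Type*} {R D : ℝ} {P : Set X} (f : X → κ)
    (hf : ∀ x ∈ P, ∀ y ∈ P, dist x y ≤ R → f x = f y)
    (h : ∀ i, BoundedAtScale R D {x ∈ P | f x = i}) : BoundedAtScale R D P := by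
  choose s h1 h2 using h
  refine ⟨⟨fun x y => f x = f y ∧ s (f x) x y, ⟨fun x => ⟨rfl, (s _).refl x⟩, ?_, ?_⟩⟩, ?_, ?_⟩
  · rintro x y ⟨h, h'⟩
    exact ⟨h.symm, h ▸ (s _).symm h'⟩
  · rintro x y z ⟨h, h'⟩ ⟨k, k'⟩
    exact ⟨h.trans k, (s _).trans h' (by rw [h]; exact k')⟩
  · intro x hx y hy hxy
    have e := hf x hx y hy hxy
    exact ⟨e, h1 (f x) x ⟨hx, rfl⟩ y ⟨hy, e.symm⟩ hxy⟩
  · rintro x hx y hy ⟨e, hs⟩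
    exact h2 (f x) x ⟨hx, rfl⟩ y ⟨hy, e.symm⟩ hs

/-! ### Translation from and to families of sets -/

theorem BoundedAtScale.of_family {R D : ℝ} {𝒰 : Set (Set X)} (hR : RDisjoint R 𝒰)
    (hD : ∀ U ∈ 𝒰, ∀ x ∈ U, ∀ y ∈ U, dist x y ≤ D) : BoundedAtScale R D (⋃₀ 𝒰) := by
  have key : ∀ x, x ∈ ⋃₀ 𝒰 → ∃ U, U ∈ 𝒰 ∧ x ∈ U := fun x hx => hx
  choose! f hf hxf using key
  refine ⟨Setoid.ker f, fun x hx y hy hxy => ?_, fun x hx y hy hxy => ?_⟩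
  · by_contra hne
    have h1 := hR.2 _ (hf x hx) _ (hf y hy) hne
    have h2 : setDist (f x) (f y) ≤ dist x y :=
      csInf_le ⟨0, by rintro _ ⟨a, _, b, _, rfl⟩; exact dist_nonneg⟩
        ⟨x, hxf x hx, y, hxf y hy, rfl⟩
    linarith
  · have e : f x = f y := hxy
    exact hD _ (hf x hx) x (hxf x hx) y (e ▸ hxf y hy)

/-- The scale drops from `R + 1` to `R` because `R`-disjointness asks for an infimum greater than
`R`. -/
theorem BoundedAtScale.exists_family {R D : ℝ} {P : Set X} (h : BoundedAtScale (R + 1) D P) :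
    ∃ 𝒰 : Set (Set X), UniformlyBounded 𝒰 ∧ RDisjoint R 𝒰 ∧ ∀ x ∈ P, ∃ U ∈ 𝒰, x ∈ U := by
  obtain ⟨s, h1, h2⟩ := h
  refine ⟨{A | ∃ x ∈ P, A = {y ∈ P | s x y}}, ⟨D, ?_⟩, ⟨?_, ?_⟩, ?_⟩
  · rintro _ ⟨x, hx, rfl⟩ y ⟨hy, hxy⟩ z ⟨hz, hxz⟩
    exact h2 y hy z hz (s.trans (s.symm hxy) hxz)
  · rintro _ ⟨x, hx, rfl⟩
    exact ⟨x, hx, s.refl x⟩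
  · rintro _ ⟨x, hx, rfl⟩ _ ⟨y, hy, rfl⟩ hne
    refine lt_of_lt_of_le (lt_add_one R) (le_csInf ?_ ?_)
    · exact ⟨_, x, ⟨hx, s.refl x⟩, y, ⟨hy, s.refl y⟩, rfl⟩
    · rintro _ ⟨a, ⟨ha, hxa⟩, b, ⟨hb, hyb⟩, rfl⟩
      by_contra hlt
      have hxy : s x y := s.trans (s.trans hxa (h1 a ha b hb (not_le.1 hlt).le)) (s.symm hyb)
      refine hne (Set.ext fun z => and_congr_right fun _ => ?_)
      exact ⟨fun hz => s.trans (s.symm hxy) hz, fun hz => s.trans hxy hz⟩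
  · exact fun x hx => ⟨_, ⟨x, hx, rfl⟩, hx, s.refl x⟩

theorem FiniteAsdim.coverableBy (h : FiniteAsdim X) : ∃ N, CoverableBy X N := by
  obtain ⟨n, hn⟩ := h
  refine ⟨n + 1, fun R => ?_⟩
  obtain ⟨𝒰, h1, h2⟩ := hn (max R 1) (by positivity)
  choose D hD using fun i : Fin (n + 1) => (h1 i (Nat.lt_succ_iff.1 i.2)).1
  obtain ⟨M, hM⟩ := (Set.finite_range D).bddAbove
  refine ⟨M, fun i => ⋃₀ 𝒰 i, fun i => ?_, fun x => ?_⟩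
  · exact (BoundedAtScale.of_family (h1 i (Nat.lt_succ_iff.1 i.2)).2 (hD i)).mono
      (le_max_left _ _) (hM ⟨i, rfl⟩)
  · obtain ⟨i, hi, U, hU, hx⟩ := h2 x
    exact ⟨⟨i, Nat.lt_succ_iff.2 hi⟩, U, hU, hx⟩

/-! ### Finite products -/

theorem CoverableBy.pi {ι : Type*} [Fintype ι] {Y : ι → Type*} [∀ i, MetricSpace (Y i)]
    (h : ∀ i, ∃ N, CoverableBy (Y i) N) : ∃ N, CoverableBy (∀ i, Y i) N := by
  classical
  choose N hN using h
  refine ⟨Fintype.card (∀ i, Fin (N i)), fun R => ?_⟩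
  choose D F hF hcov using fun i => hN i (max R 0)
  choose s h1 h2 using hF
  obtain ⟨M, hM⟩ := (Set.finite_range D).bddAbove
  refine ⟨max M 0, fun c => {x | ∀ i, x i ∈ F i ((Fintype.equivFin _).symm c i)},
    fun c => ⟨⟨fun x y => ∀ i, s i ((Fintype.equivFin _).symm c i) (x i) (y i),
      ⟨fun x i => (s i _).refl _, fun h i => (s i _).symm (h i),
        fun h h' i => (s i _).trans (h i) (h' i)⟩⟩, ?_, ?_⟩, ?_⟩
  · intro x hx y hy hxy i
    exact h1 i _ _ (hx i) _ (hy i)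
      ((dist_le_pi_dist x y i).trans (hxy.trans (le_max_left _ _)))
  · intro x hx y hy hxy
    refine (dist_pi_le_iff (le_max_right _ _)).2 fun i => ?_
    exact (h2 i _ _ (hx i) _ (hy i) (hxy i)).trans ((hM ⟨i, rfl⟩).trans (le_max_left _ _))
  · intro x
    choose c hc using fun i => hcov i (x i)
    exact ⟨Fintype.equivFin _ c, by simpa using hc⟩

/-! ### Kolmogorov's trick -/

open Classical in
/-- From `N` families covering the space one obtains, for each `k`, `N + k` families such that
every point is missed by fewer than `N` of them. The new family in the inductive step consists of
the points lying in the least possible number, `k + 1`, of the enlarged old ones: the set of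
indices of these is locally constant there. -/
theorem CoverableBy.exists_overlapping {N : ℕ} (h : CoverableBy X N) (k : ℕ) :
    ∀ R : ℝ, 0 ≤ R → ∃ (D : ℝ) (F : ℕ → Set X), (∀ c, BoundedAtScale R D (F c)) ∧
      ∀ x, k + 1 ≤ #{c ∈ range (N + k) | x ∈ F c} := by
  induction k with
  | zero =>
    intro R _
    obtain ⟨D, F, hF, hcov⟩ := h R
    refine ⟨D, fun c => if hc : c < N then F ⟨c, hc⟩ else ∅, fun c => ?_, fun x => ?_⟩
    · by_cases hc : c < N
      · simpa [hc] using hF _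
      · simpa [hc] using boundedAtScale_empty R D
    · obtain ⟨i, hi⟩ := hcov x
      refine Finset.card_pos.2 ⟨i, ?_⟩
      simp [hi]
  | succ k ih =>
    intro R hR
    obtain ⟨D, F, hF, hcov⟩ := ih (R + 2 * R) (by positivity)
    let A : X → Finset ℕ := fun x => {c ∈ range (N + k) | x ∈ enlarge R (F c)}
    have hE : ∀ c, BoundedAtScale R (D + 2 * R) (enlarge R (F c)) := fun c => (hF c).enlarge
    have hA : ∀ x y, dist x y ≤ R → {c ∈ range (N + k) | x ∈ F c} ⊆ A y := by
      intro x y hxy c hc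
      simp only [Finset.mem_filter, A] at hc ⊢
      exact ⟨hc.1, x, hc.2, by rwa [dist_comm]⟩
    have hAx : ∀ x, {c ∈ range (N + k) | x ∈ F c} ⊆ A x := fun x => hA x x (by simpa)
    have hQ : BoundedAtScale R (D + 2 * R) {x | #(A x) = k + 1} := by
      refine boundedAtScale_of_fibers A (fun x hx y hy hxy => ?_) (fun σ => ?_)
      · rw [← Finset.eq_of_subset_of_card_le (hAx x) (hx.trans_le (hcov x)),
          ← Finset.eq_of_subset_of_card_le (hA x y hxy) (hy.trans_le (hcov x))]
      · rcases σ.eq_empty_or_nonempty with rfl | ⟨c, hc⟩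
        · convert boundedAtScale_empty R (D + 2 * R)
          ext x
          simp only [Set.mem_ofPred_eq, Set.mem_empty_iff_false, iff_false, not_and]
          intro hx hx'
          simp [hx'] at hx
        · obtain ⟨s, h1, h2⟩ := hE c
          have hm : ∀ x ∈ {x ∈ {x | #(A x) = k + 1} | A x = σ}, x ∈ enlarge R (F c) := by
            rintro x ⟨_, hx⟩
            rw [← hx] at hc
            exact (Finset.mem_filter.1 hc).2
          exact ⟨s, fun x hx y hy => h1 x (hm x hx) y (hm y hy),
            fun x hx y hy => h2 x (hm x hx) y (hm y hy)⟩
    refine ⟨D + 2 * R, fun c => if c < N + k then enlarge R (F c) else {x | #(A x) = k + 1},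
      fun c => ?_, fun x => ?_⟩
    · by_cases hc : c < N + k
      · simpa [hc] using hE c
      · simpa [hc] using hQ
    · have hsub : A x ⊆ {c ∈ range (N + (k + 1)) |
          x ∈ if c < N + k then enlarge R (F c) else {x | #(A x) = k + 1}} := by
        intro c hc
        simp only [Finset.mem_filter, Finset.mem_range, A] at hc ⊢
        exact ⟨by omega, by simpa [hc.1] using hc.2⟩
      have hle : k + 1 ≤ #(A x) := (hcov x).trans (Finset.card_le_card (hAx x))
      rcases hle.eq_or_lt with heq | hlt
      · refine Nat.succ_le_of_lt (heq.trans_lt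
          (Finset.card_lt_card (hsub.ssubset_of_mem_notMem (a := N + k) ?_ ?_)))
        · simp [← heq]
        · simp [A]
      · exact hlt.trans_le (Finset.card_le_card hsub)

/-! ### Covers of a product with a discrete factor -/

/-- The number of elements of `σ` below `c`. -/
def rankIn (σ : Finset ℕ) (c : ℕ) : ℕ := #{d ∈ σ | d < c}

theorem rankIn_lt_card {σ : Finset ℕ} {c : ℕ} (hc : c ∈ σ) : rankIn σ c < #σ :=
  Finset.card_lt_card (Finset.filter_ssubset.2 ⟨c, hc, lt_irrefl c⟩)

theorem rankIn_injOn (σ : Finset ℕ) : Set.InjOn (rankIn σ) σ := by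
  have key : ∀ c ∈ σ, ∀ d, c < d → rankIn σ c < rankIn σ d := by
    intro c hc d hcd
    refine Finset.card_lt_card (Finset.ssubset_iff_of_subset ?_ |>.2 ⟨c, ?_, ?_⟩)
    · intro e he
      simp only [Finset.mem_filter] at he ⊢
      exact ⟨he.1, he.2.trans hcd⟩
    · simp [hc, hcd]
    · simp
  intro c hc d hd h
  rcases lt_trichotomy c d with hlt | heq | hlt
  · exact absurd h (key c hc d hlt).ne
  · exact heq
  · exact absurd h (key d hd c hlt).ne'

/-- A decreasing sequence of finite sets starting with at most `N` elements is constant over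
two steps from some `2 * a` with `a < N`, if it is not empty by then. -/
theorem exists_stable_step {α : Type*} (S : ℕ → Finset α) (hS : Antitone S) {N : ℕ}
    (h0 : #(S 0) ≤ N) (hne : (S (2 * N)).Nonempty) : ∃ a < N, S (2 * a) = S (2 * a + 2) := by
  by_contra! hcon
  have key : ∀ a ≤ N, #(S (2 * a)) + a ≤ N := by
    intro a
    induction a with
    | zero => intro _; simpa using h0
    | succ a ih =>
      intro ha
      have h1 := ih (by omega)
      have h2 : S (2 * a + 2) ⊂ S (2 * a) :=
        (hS (by omega)).ssubset_of_ne (hcon a (by omega)).symm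
      have h3 := Finset.card_lt_card h2
      rw [show 2 * (a + 1) = 2 * a + 2 by ring]
      omega
  have h1 := key N le_rfl
  have h2 := hne.card_pos
  omega

open Classical in
/-- The space `X` is viewed as a subspace of `H × T × W` by the maps `p`, `q`, `τ`. The factor `T`
is discrete at scale `R₀` and `W` is discrete at scale `R₁`. The number of pieces at scale `R₁`
depends only on `H`. -/
theorem exists_cover_of_split {H T W : Type*} [MetricSpace H] [MetricSpace T] {N m : ℕ}
    (hH : CoverableBy H N) (hT : CoverableBy T m) (p : X → H) (q : X → T) (τ : X → W)
    (hp : ∀ x y, dist (p x) (p y) ≤ dist x y) (hq : ∀ x y, dist (q x) (q y) ≤ dist x y)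
    (hb : ∀ D, ∃ D', ∀ x y, dist (p x) (p y) ≤ D → dist (q x) (q y) ≤ D → τ x = τ y →
      dist x y ≤ D')
    {R₀ R₁ : ℝ} (hR₁ : 0 ≤ R₁) (hR : R₀ ≤ R₁)
    (hd₀ : ∀ x y, dist x y ≤ R₀ → q x = q y) (hd₁ : ∀ x y, dist x y ≤ R₁ → τ x = τ y) :
    ∃ (D : ℝ) (P₀ : Set X) (P : Fin N × Fin N × Fin N → Set X), BoundedAtScale R₀ D P₀ ∧
      (∀ i, BoundedAtScale R₁ D (P i)) ∧ ∀ x, x ∈ P₀ ∨ ∃ i, x ∈ P i := by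
  obtain ⟨DT, Q, hQ, hQcov⟩ := hT R₁
  obtain ⟨DE, E, hE, hEcov⟩ := hH R₁
  -- `2 * N` successive enlargements by `R₁` have to remain bounded at scale `R₁`.
  obtain ⟨DF, F, hF, hFcov⟩ := hH.exists_overlapping m (R₁ + 2 * ((2 * N : ℕ) * R₁))
    (by positivity)
  choose col hcol using hQcov
  let S : ℕ → H → Finset ℕ := fun s h => {c ∈ range (N + m) | h ∉ enlarge (s * R₁) (F c)}
  have hS : ∀ h, Antitone fun s => S s h := by
    intro h s t hst c hc
    simp only [Finset.mem_filter, S] at hc ⊢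
    refine ⟨hc.1, fun ⟨y, hy, hle⟩ => hc.2 ⟨y, hy, hle.trans ?_⟩⟩
    gcongr
  have hSstep : ∀ s h h', dist h h' ≤ R₁ → S (s + 1) h ⊆ S s h' := by
    intro s h h' hh c hc
    simp only [Finset.mem_filter, S] at hc ⊢
    refine ⟨hc.1, fun ⟨y, hy, hle⟩ => hc.2 ⟨y, hy, ?_⟩⟩
    push_cast
    linarith [dist_triangle h h' y]
  have hScard : ∀ h, #(S 0 h) ≤ N := by
    intro h
    have h1 : #{c ∈ range (N + m) | h ∈ F c} + #{c ∈ range (N + m) | h ∉ F c} = N + m := by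
      rw [Finset.card_filter_add_card_filter_not, Finset.card_range]
    have h2 : S 0 h ⊆ {c ∈ range (N + m) | h ∉ F c} := by
      intro c hc
      simp only [Finset.mem_filter, S] at hc ⊢
      exact ⟨hc.1, fun hh => hc.2 ⟨h, hh, by simp⟩⟩
    have h3 := Finset.card_le_card h2
    have h4 := hFcov h
    omega
  obtain ⟨D₀, hD₀⟩ := hb (max (DF + 2 * ((2 * N : ℕ) * R₁)) 0)
  obtain ⟨D₁, hD₁⟩ := hb (max DE DT)
  refine ⟨max D₀ D₁, {x | p x ∈ enlarge ((2 * N : ℕ) * R₁) (F (col (q x)))},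
    fun i => {x | p x ∈ E i.1 ∧ S (2 * i.2.1) (p x) = S (2 * i.2.1 + 2) (p x) ∧
      (col (q x) : ℕ) ∈ S (2 * i.2.1 + 1) (p x) ∧
      rankIn (S (2 * i.2.1 + 1) (p x)) (col (q x)) = i.2.2}, ?_, ?_, ?_⟩
  · refine BoundedAtScale.mono ?_ le_rfl (le_max_left _ _)
    refine boundedAtScale_of_fibers (fun x => (q x, τ x)) (fun x _ y _ hxy => ?_) ?_
    · exact Prod.ext (hd₀ x y hxy) (hd₁ x y (hxy.trans hR))
    · rintro ⟨t, w⟩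
      obtain ⟨s, h1, h2⟩ := (hF (col t)).enlarge
      have hm : ∀ x ∈ {x ∈ {x | p x ∈ enlarge ((2 * N : ℕ) * R₁) (F (col (q x)))} |
          (q x, τ x) = (t, w)},
          p x ∈ enlarge ((2 * N : ℕ) * R₁) (F (col t)) ∧ q x = t ∧ τ x = w := by
        rintro x ⟨hx, hx'⟩
        obtain ⟨rfl, rfl⟩ := Prod.mk.inj hx'
        exact ⟨hx, rfl, rfl⟩
      refine ⟨s.comap p, fun x hx y hy hxy => ?_, fun x hx y hy hxy => ?_⟩
      · exact h1 _ (hm x hx).1 _ (hm y hy).1 ((hp x y).trans (hxy.trans hR))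
      · refine hD₀ x y ?_ ?_ ((hm x hx).2.2.trans (hm y hy).2.2.symm)
        · exact (h2 _ (hm x hx).1 _ (hm y hy).1 hxy).trans (le_max_left _ _)
        · rw [(hm x hx).2.1, (hm y hy).2.1, dist_self]
          exact le_max_right _ _
  · rintro ⟨i, a, j⟩
    refine BoundedAtScale.mono ?_ le_rfl (le_max_right _ _)
    refine boundedAtScale_of_fibers (fun x => (col (q x), τ x)) ?_ ?_
    · rintro x ⟨-, hxa, hxc, hxj⟩ y ⟨-, hya, hyc, hyj⟩ hxy
      refine Prod.ext ?_ (hd₁ x y hxy)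
      have hpxy := (hp x y).trans hxy
      -- The levels `2a`, `2a+1`, `2a+2` agree at `p y`, and likewise at `p x`.
      have heq : S (2 * a + 1) (p x) = S (2 * a + 1) (p y) := by
        refine subset_antisymm ?_ ?_
        · exact (hSstep _ _ _ hpxy).trans
            (hya.subset.trans (hS (p y) (Nat.le_succ (2 * a + 1))))
        · exact (hSstep _ _ _ (by rwa [dist_comm])).trans
            (hxa.subset.trans (hS (p x) (Nat.le_succ (2 * a + 1))))
      simp only at hxc hyc hxj hyj
      rw [← heq] at hyc hyj
      exact Fin.ext (rankIn_injOn _ hxc hyc (hxj.trans hyj.symm))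
    · rintro ⟨c, w⟩
      obtain ⟨s, h1, h2⟩ := hE i
      obtain ⟨s', h1', h2'⟩ := hQ c
      refine ⟨s.comap p ⊓ s'.comap q, ?_, ?_⟩
      · rintro x ⟨⟨hx, -⟩, hx'⟩ y ⟨⟨hy, -⟩, hy'⟩ hxy
        obtain ⟨rfl, rfl⟩ := Prod.mk.inj hx'
        obtain ⟨e, -⟩ := Prod.mk.inj hy'
        exact ⟨h1 _ hx _ hy ((hp x y).trans hxy),
          h1' _ (hcol _) _ (e ▸ hcol _) ((hq x y).trans hxy)⟩
      · rintro x ⟨⟨hx, -⟩, hx'⟩ y ⟨⟨hy, -⟩, hy'⟩ ⟨hxy, hxy'⟩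
        obtain ⟨rfl, rfl⟩ := Prod.mk.inj hx'
        obtain ⟨e, e'⟩ := Prod.mk.inj hy'
        exact hD₁ x y ((h2 _ hx _ hy hxy).trans (le_max_left _ _))
          ((h2' _ (hcol _) _ (e ▸ hcol _) hxy').trans (le_max_right _ _)) e'.symm
  · intro x
    by_cases hx : p x ∈ enlarge ((2 * N : ℕ) * R₁) (F (col (q x)))
    · exact Or.inl hx
    · right
      have hmem : (col (q x) : ℕ) ∈ S (2 * N) (p x) := by
        simp only [Finset.mem_filter, Finset.mem_range, S]
        exact ⟨by omega, hx⟩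
      obtain ⟨a, ha, hst⟩ := exists_stable_step (fun s => S s (p x)) (hS _) (hScard _) ⟨_, hmem⟩
      have hmem' : (col (q x) : ℕ) ∈ S (2 * a + 1) (p x) := hS (p x) (by omega) hmem
      obtain ⟨i, hi⟩ := hEcov (p x)
      have hlt : rankIn (S (2 * a + 1) (p x)) (col (q x)) < N :=
        (rankIn_lt_card hmem').trans_le
          ((Finset.card_le_card (hS (p x) (Nat.zero_le _))).trans (hScard _))
      exact ⟨(i, ⟨a, ha⟩, ⟨_, hlt⟩), hi, hst, hmem', rfl⟩

/-! ### Restricted products -/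

namespace RestrictedProd

variable {Y : ℕ → Type*} [∀ i, MetricSpace (Y i)] {b : ∀ i, Y i}

/-- The projection to the factors with index in `s`; the finite product carries the maximum
metric. -/
def proj (s : Finset ℕ) (x : RestrictedProd Y b) (i : s) : Y i := x.val i

theorem weighted_dist_le (x y : RestrictedProd Y b) (i : ℕ) :
    ((i : ℝ) + 1) * dist (x.val i) (y.val i) ≤ dist x y :=
  (summable_dist x y).le_tsum i fun _ _ => by positivity

theorem dist_proj_le (s : Finset ℕ) (x y : RestrictedProd Y b) :
    dist (proj s x) (proj s y) ≤ dist x y := by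
  have hnn : 0 ≤ dist x y := dist_nonneg
  refine (dist_pi_le_iff hnn).2 fun i => le_trans ?_ (weighted_dist_le x y i)
  exact le_mul_of_one_le_left dist_nonneg (by simp)

theorem dist_le_of_tail_eq {k : ℕ} {D : ℝ} {x y : RestrictedProd Y b}
    (h : ∀ i < k, dist (x.val i) (y.val i) ≤ D) (ht : ∀ i, k ≤ i → x.val i = y.val i) :
    dist x y ≤ ∑ i ∈ Finset.range k, ((i : ℝ) + 1) * D := by
  rw [dist_def, tsum_eq_sum (s := Finset.range k)]
  · refine Finset.sum_le_sum fun i hi => ?_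
    exact mul_le_mul_of_nonneg_left (h i (Finset.mem_range.1 hi)) (by positivity)
  · intro i hi
    rw [ht i (by simpa using hi), dist_self, mul_zero]

/-- In a restricted product of groups whose weighted metrics become more and more discrete, nearby
points agree in all but boundedly many coordinates. -/
theorem exists_tail_eq {G : ℕ → Type*} [∀ i, Group (G i)] [∀ i, MetricSpace (G i)]
    (hinv : ∀ (i : ℕ) (g x y : G i), dist (g * x) (g * y) = dist x y)
    (hsep : ∀ r : ℝ, ∀ᶠ i : ℕ in Filter.atTop,
      ∀ g : G i, g ≠ 1 → r ≤ ((i : ℝ) + 1) * dist g 1) (R : ℝ) :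
    ∃ k : ℕ, ∀ x y : RestrictedProd G (fun _ => 1), dist x y ≤ R →
      ∀ i, k ≤ i → x.val i = y.val i := by
  obtain ⟨k, hk⟩ := Filter.eventually_atTop.1 (hsep (R + 1))
  refine ⟨k, fun x y hxy i hi => ?_⟩
  by_contra hne
  have h1 := hk i hi ((y.val i)⁻¹ * x.val i) fun h => hne (inv_mul_eq_one.1 h).symm
  have h2 := weighted_dist_le x y i
  rw [← inv_mul_cancel (y.val i), hinv] at h1
  linarith

end RestrictedProd

/-- It suffices to cover the space by one set that is bounded at scale `R 0` and `L` sets bounded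
at scale `R L`, up to an increase of the scales by `1`. -/
theorem asymptoticPropertyC_of_cover
    (h : ∀ R₀ : ℝ, 0 < R₀ → ∃ L : ℕ, ∀ R₁ ≥ R₀, ∃ (D : ℝ) (P₀ : Set X) (P : Fin L → Set X),
      BoundedAtScale R₀ D P₀ ∧ (∀ i, BoundedAtScale R₁ D (P i)) ∧
        ∀ x, x ∈ P₀ ∨ ∃ i, x ∈ P i) :
    AsymptoticPropertyC X := by
  intro R hpos hmono
  obtain ⟨L, hL⟩ := h (R 0 + 1) (by linarith [hpos 0])
  obtain ⟨D, P₀, P, h₀, h₁, hcov⟩ := hL (R L + 1) (by linarith [hmono (Nat.zero_le L)])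
  let Q : ℕ → Set X := fun i =>
    if i = 0 then P₀ else if hi : i - 1 < L then P ⟨i - 1, hi⟩ else ∅
  have hQ : ∀ i ≤ L, BoundedAtScale (R i + 1) D (Q i) := by
    rintro (_ | i) hi
    · simpa [Q] using h₀
    · have hi' : i < L := hi
      simpa [Q, hi'] using (h₁ ⟨i, hi'⟩).mono (by linarith [hmono hi]) le_rfl
  have key : ∀ i, ∃ 𝒰 : Set (Set X), i ≤ L →
      UniformlyBounded 𝒰 ∧ RDisjoint (R i) 𝒰 ∧ ∀ x ∈ Q i, ∃ U ∈ 𝒰, x ∈ U := by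
    intro i
    by_cases hi : i ≤ L
    · obtain ⟨𝒰, h𝒰⟩ := (hQ i hi).exists_family
      exact ⟨𝒰, fun _ => h𝒰⟩
    · exact ⟨∅, fun h => absurd h hi⟩
  choose 𝒰 h𝒰 using key
  refine ⟨L, 𝒰, fun i hi => ⟨(h𝒰 i hi).1, (h𝒰 i hi).2.1⟩, fun x => ?_⟩
  rcases hcov x with hx | ⟨i, hx⟩
  · exact ⟨0, Nat.zero_le L, (h𝒰 0 (Nat.zero_le L)).2.2 x (by simpa [Q] using hx)⟩
  · exact ⟨i + 1, i.2, (h𝒰 (i + 1) i.2).2.2 x (by simpa [Q] using hx)⟩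

end AsympC

theorem theorem3p4 {G : ℕ → Type*} [∀ i, Group (G i)] [∀ i, Countable (G i)]
    [∀ i, MetricSpace (G i)] [∀ i, ProperSpace (G i)]
    (hinv : ∀ (i : ℕ) (g x y : G i), dist (g * x) (g * y) = dist x y)
    (hsep : ∀ r : ℝ, ∀ᶠ i : ℕ in Filter.atTop,
      ∀ g : G i, g ≠ 1 → r ≤ ((i : ℝ) + 1) * dist g 1)
    (hasdim : ∀ i, AsympC.FiniteAsdim (G i)) :
    AsympC.AsymptoticPropertyC (AsympC.RestrictedProd G (fun _ => 1)) := by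
  open AsympC RestrictedProd in
  refine asymptoticPropertyC_of_cover fun R₀ hR₀ => ?_
  obtain ⟨k₀, hk₀⟩ := exists_tail_eq hinv hsep R₀
  obtain ⟨N, hN⟩ := CoverableBy.pi fun i : Finset.range k₀ => (hasdim i).coverableBy
  refine ⟨Fintype.card (Fin N × Fin N × Fin N), fun R₁ hR => ?_⟩
  obtain ⟨k, hk⟩ := exists_tail_eq hinv hsep R₁
  obtain ⟨m, hm⟩ := CoverableBy.pi fun i : Finset.Ico k₀ k => (hasdim i).coverableBy
  obtain ⟨D, P₀, P, h₀, h₁, hcov⟩ := exists_cover_of_split hN hm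
    (proj (b := fun _ => 1) (Finset.range k₀)) (proj (Finset.Ico k₀ k))
    (fun x (i : Set.Ici k) => x.val i) (dist_proj_le _) (dist_proj_le _)
    (fun D => ⟨∑ i ∈ Finset.range k, ((i : ℝ) + 1) * D, fun x y hp hq ht => by
      refine dist_le_of_tail_eq (fun i hi => ?_) (fun i hi => congrFun ht ⟨i, hi⟩)
      rcases lt_or_ge i k₀ with hlt | hge
      · exact (dist_le_pi_dist _ _ (⟨i, Finset.mem_range.2 hlt⟩ : Finset.range k₀)).trans hp
      · exact (dist_le_pi_dist _ _
          (⟨i, Finset.mem_Ico.2 ⟨hge, hi⟩⟩ : Finset.Ico k₀ k)).trans hq⟩)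
    (hR₀.le.trans hR) hR
    (fun x y hxy => funext fun i => hk₀ x y hxy i (Finset.mem_Ico.1 i.2).1)
    (fun x y hxy => funext fun i => hk x y hxy i i.2)
  refine ⟨D, P₀, P ∘ (Fintype.equivFin _).symm, h₀, fun i => h₁ _, fun x => ?_⟩
  exact (hcov x).imp_right fun ⟨i, hi⟩ => ⟨Fintype.equivFin _ i, by simpa using hi⟩
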